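/- Let $\mathbb{K}$ be a field. For a shift $s=(s_1,\dots,s_m)\in\mathbb{Z}^m$, the $s$-degree of a row vector $p\in\mathbb{K}[x]^{1\times m}$ is $\max_j (s_j+\deg p_j)$, with $\deg 0=-\infty$. For a matrix $P$ over $\mathbb{K}[x]$, $\operatorname{rdeg}_s P$ is the list of the $s$-degrees of its rows, $\operatorname{rdeg}P=\operatorname{rdeg}_0P$, and $\operatorname{cdeg}P$ is the list of the degrees of its columns. With $t=\operatorname{rdeg}_sP$, the $s$-leading matrix of $P$ is the matrix over $\mathbb{K}$ whose entry $(i,j)$ is the coefficient of degree $t_i-s_j$ of $P_{i,j}$ (and $0$ if row $i$ of $P$ is zero); $P$ is $s$-reduced if this matrix has full row rank, and column reduced if $P^{\mathsf T}$ is $0$-reduced. A basis of a submodule of $\mathbb{K}[x]^{1\times m}$ is represented by the matrix whose rows are the basis elements. Let $F\in\mathbb{K}[x]^{m\times n}$ have rank $r$, let $\operatorname{Ker}(F)=\{p\in\mathbb{K}[x]^{1\times m}\mid pF=0\}$, and for $M\in\mathbb{K}[x]^{n\times n}$ let $\operatorname{Rel}_M(F)=\{p\in\mathbb{K}[x]^{1\times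 m}\mid pF=qM\text{ for some }q\in\mathbb{K}[x]^{1\times n}\}$. Let $s\in\mathbb{N}^m$ be such that $s\ge\operatorname{rdeg}F$ entrywise and $|s|:=s_1+\cdots+s_m>0$. Let $k>0$ be a real number and let $\tau=\lceil |s|/k\rceil$. (1) If $K\in\mathbb{K}[x]^{(m-r)\times m}$ is an $s$-reduced basis of $\operatorname{Ker}(F)$, then at most $\lfloor k\rfloor$ rows of $K$ have $s$-degree at least $\tau$. (2) If $M\in\mathbb{K}[x]^{n\times n}$ is column reduced with all column degrees at least $\tau$, and $A\in\mathbb{K}[x]^{m\times m}$ is an $s$-reduced basis of $\operatorname{Rel}_M(F)$, then at most $r+\lfloor k\rfloor$ rows of $A$ are not in $\operatorname{Ker}(F)$. -/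

import Mathlib

open Polynomial Matrix

noncomputable section

namespace PolyMat

variable {𝕜 : Type*} [Field 𝕜] {ι κ ν : Type*} [Fintype ι] [Fintype κ] [Fintype ν]

/-- The `s`-degree `max_j (s_j + deg p_j)` of a row vector `p`, for a shift `s`. It takes values in
`ℤ ∪ {-∞}`; the zero vector (and the vector without entries) has `s`-degree `⊥ = -∞`. -/
def shiftedDegree (s : κ → ℤ) (p : κ → 𝕜[X]) : WithBot ℤ :=
  Finset.univ.sup fun j => (s j : WithBot ℤ) + (p j).degree.map (fun d : ℕ => (d : ℤ))

/-- The list `rdeg_s P` of the `s`-degrees of the rows of `P`. -/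
def rowDegree (s : κ → ℤ) (P : Matrix ι κ 𝕜[X]) : ι → WithBot ℤ :=
  fun i => shiftedDegree s (P i)

/-- The list `cdeg P` of the (unshifted) degrees of the columns of `P`. -/
def colDegree (P : Matrix ι κ 𝕜[X]) : κ → WithBot ℤ :=
  rowDegree 0 Pᵀ

/-- The coefficient of `x ^ d` in `p`, for an integer `d`; it is zero if `d < 0`. -/
def intCoeff (p : 𝕜[X]) (d : ℤ) : 𝕜 :=
  if 0 ≤ d then p.coeff d.toNat else 0

/-- The `s`-leading matrix of `P`: with `t = rdeg_s P`, its entry `(i, j)` is the coefficient of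
degree `0` of `x ^ (-t_i) * P_ij * x ^ (s_j)`, that is, the coefficient of degree `t_i - s_j` of
`P_ij`. A zero row of `P` gives a zero row. -/
def leadingMatrix (s : κ → ℤ) (P : Matrix ι κ 𝕜[X]) : Matrix ι κ 𝕜 :=
  Matrix.of fun i j =>
    match rowDegree s P i with
    | none => 0
    | some t => intCoeff (P i j) (t - s j)

/-- `P` is `s`-(row) reduced: its `s`-leading matrix has full row rank. -/
def IsReduced (s : κ → ℤ) (P : Matrix ι κ 𝕜[X]) : Prop :=
  (leadingMatrix s P).rank = Fintype.card ι

/-- `P` is column reduced: its transpose is row reduced for the zero shift. -/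
def IsColReduced (P : Matrix ι κ 𝕜[X]) : Prop :=
  IsReduced 0 Pᵀ

/-- The left kernel `{p | p F = 0}`. -/
def leftKernel (F : Matrix ι κ 𝕜[X]) : Submodule 𝕜[X] (ι → 𝕜[X]) :=
  LinearMap.ker F.vecMulLinear

/-- The left relation module `{p | p F = 0 mod M}`, where `p F = 0 mod M` means that `p F = q M`
for some row vector `q`. -/
def relationModule (M : Matrix κ κ 𝕜[X]) (F : Matrix ι κ 𝕜[X]) : Submodule 𝕜[X] (ι → 𝕜[X]) :=
  (LinearMap.range M.vecMulLinear).comap F.vecMulLinear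

/-- The rows of `B` form a basis of the module `N`. -/
def IsRowBasis (B : Matrix ν ι 𝕜[X]) (N : Submodule 𝕜[X] (ι → 𝕜[X])) : Prop :=
  LinearIndependent 𝕜[X] (fun i => B i) ∧ Submodule.span 𝕜[X] (Set.range fun i => B i) = N

end PolyMat

end

namespace PolyMat

/-! Let T = τ. Vectors p of s-degree less than T form a 𝕜-space of dimension at least mT - |s|.
Since s bounds the row degrees of F, pF has degree less than T; as r columns of F already determine
the kernel, pF = 0 amounts to at most rT linear conditions. Conversely, if an s-reduced B spans a
module containing Ker(F), predictable degrees (`degreeAtMost_of_vecMul`) write each such kernel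
vector using only rows of B of s-degree less than T, with coefficients of degree less than T. So
these rows number at least m - r - |s|/T ≥ m - r - k, which bounds the others. For (2), a row p of A
of s-degree less than τ has pF of degree less than τ in the row space of M, so pF = 0 by
`IsColReduced.vecMul_eq_zero`. -/

/-- The degree of `p` is at most the integer `a`; for `a < 0` this means `p = 0`. -/
def DegreeAtMost {𝕜 : Type*} [Field 𝕜] (p : 𝕜[X]) (a : ℤ) : Prop :=
  ∀ n : ℕ, a < n → p.coeff n = 0

/-! ### Degree bounds and the predictable degree property -/

section

variable {𝕜 : Type*} [Field 𝕜] {ι κ ν : Type*}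

theorem DegreeAtMost.mono {p : 𝕜[X]} {a b : ℤ} (h : DegreeAtMost p a) (hab : a ≤ b) :
    DegreeAtMost p b :=
  fun n hn => h n (by omega)

theorem DegreeAtMost.eq_zero {p : 𝕜[X]} {a : ℤ} (h : DegreeAtMost p a) (ha : a < 0) : p = 0 :=
  Polynomial.ext fun n => by simpa using h n (by omega)

theorem degreeAtMost_zero (a : ℤ) : DegreeAtMost (0 : 𝕜[X]) a := fun _ _ => by simp

theorem degreeAtMost_natCast {p : 𝕜[X]} {a : ℕ} : DegreeAtMost p a ↔ p.natDegree ≤ a := by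
  rw [Polynomial.natDegree_le_iff_coeff_eq_zero]
  exact ⟨fun h n hn => h n (by exact_mod_cast hn), fun h n hn => h n (by exact_mod_cast hn)⟩

theorem mem_degreeLT_iff {p : 𝕜[X]} {a : ℕ} :
    p ∈ Polynomial.degreeLT 𝕜 a ↔ DegreeAtMost p ((a : ℤ) - 1) := by
  rw [Polynomial.mem_degreeLT, Polynomial.degree_lt_iff_coeff_zero]
  exact ⟨fun h n hn => h n (by omega), fun h n hn => h n (by omega)⟩

theorem DegreeAtMost.sum {α : Type*} {t : Finset α} {f : α → 𝕜[X]} {a : ℤ}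
    (h : ∀ i ∈ t, DegreeAtMost (f i) a) : DegreeAtMost (∑ i ∈ t, f i) a := fun n hn => by
  rw [Polynomial.finsetSum_coeff]
  exact Finset.sum_eq_zero fun i hi => h i hi n hn

theorem DegreeAtMost.mul {p q : 𝕜[X]} {a b : ℤ} (hp : DegreeAtMost p a) (hq : DegreeAtMost q b) :
    DegreeAtMost (p * q) (a + b) := fun n hn => by
  rw [Polynomial.coeff_mul]
  refine Finset.sum_eq_zero fun x hx => ?_
  rw [Finset.HasAntidiagonal.mem_antidiagonal] at hx
  by_cases h : a < x.1
  · rw [hp _ h, zero_mul]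
  · rw [hq _ (by omega), mul_zero]

theorem intCoeff_natCast (p : 𝕜[X]) (n : ℕ) : intCoeff p n = p.coeff n := by
  simp [intCoeff]

theorem intCoeff_zero (a : ℤ) : intCoeff (0 : 𝕜[X]) a = 0 := by
  simp [intCoeff]

theorem DegreeAtMost.intCoeff_eq_zero {p : 𝕜[X]} {a b : ℤ} (h : DegreeAtMost p a) (hab : a < b) :
    intCoeff p b = 0 := by
  unfold intCoeff
  split_ifs with hb
  · exact h _ (by omega)
  · rfl

theorem intCoeff_sum {α : Type*} (t : Finset α) (f : α → 𝕜[X]) (a : ℤ) :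
    intCoeff (∑ i ∈ t, f i) a = ∑ i ∈ t, intCoeff (f i) a := by
  unfold intCoeff
  split_ifs <;> simp [Polynomial.finsetSum_coeff]

theorem DegreeAtMost.intCoeff_mul {p q : 𝕜[X]} {a b : ℤ} (hp : DegreeAtMost p a)
    (hq : DegreeAtMost q b) : intCoeff (p * q) (a + b) = intCoeff p a * intCoeff q b := by
  rcases lt_or_ge a 0 with ha | ha
  · simp [hp.eq_zero ha, intCoeff_zero]
  rcases lt_or_ge b 0 with hb | hb
  · simp [hq.eq_zero hb, intCoeff_zero]
  lift a to ℕ using ha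
  lift b to ℕ using hb
  rw [← Nat.cast_add]
  simp only [intCoeff_natCast]
  exact Polynomial.coeff_mul_add_eq_of_natDegree_le (degreeAtMost_natCast.1 hp)
    (degreeAtMost_natCast.1 hq)

theorem DegreeAtMost.of_intCoeff_eq_zero {p : 𝕜[X]} {a : ℤ} (h : DegreeAtMost p a)
    (h0 : intCoeff p a = 0) : DegreeAtMost p (a - 1) := fun n hn => by
  rcases (show a ≤ n by omega).lt_or_eq with hlt | rfl
  · exact h n hlt
  · rwa [intCoeff_natCast] at h0

/-- The predictable degree property, for row degrees `δ` and shift `σ`. -/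
theorem degreeAtMost_of_vecMul [Fintype ι] {B : Matrix ι κ 𝕜[X]} {δ : ι → ℤ} {σ : κ → ℤ}
    (hB : ∀ i j, DegreeAtMost (B i j) (δ i - σ j))
    (hL : LinearIndependent 𝕜 (Matrix.of fun i j => intCoeff (B i j) (δ i - σ j)).row)
    {u : ι → 𝕜[X]} {τ : ℤ} (hu : ∀ j, DegreeAtMost ((u ᵥ* B) j) (τ - σ j)) (i : ι) :
    DegreeAtMost (u i) (τ - δ i) := by
  have descend : ∀ N : ℕ, (∀ i, DegreeAtMost (u i) (τ + N - δ i)) →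
      ∀ i, DegreeAtMost (u i) (τ - δ i) := by
    intro N
    induction N with
    | zero => simp
    | succ N ih =>
      intro h
      refine ih fun i => ?_
      -- The top coefficients of u form a vector killed by the leading matrix, because u B has no
      -- terms in that degree; independence makes them vanish, so the bound drops by one.
      have hc : (fun i => intCoeff (u i) (τ + (N + 1 : ℕ) - δ i)) = 0 := by
        refine Matrix.vecMul_injective_iff.2 hL ?_
        ext j
        have := (hu j).intCoeff_eq_zero (show τ - σ j < τ + (N + 1 : ℕ) - σ j by omega)
        rw [Matrix.vecMul, dotProduct, intCoeff_sum] at this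
        change (_ ᵥ* _) j = (0 ᵥ* _) j
        rw [Matrix.zero_vecMul, Pi.zero_apply, ← this, Matrix.vecMul, dotProduct]
        refine Finset.sum_congr rfl fun i _ => ?_
        rw [Matrix.of_apply, ← (h i).intCoeff_mul (hB i j)]
        congr 1
        ring
      exact ((h i).of_intCoeff_eq_zero (congrFun hc i)).mono (by push_cast; omega)
  obtain ⟨N, hN⟩ : ∃ N : ℕ, ∀ i, DegreeAtMost (u i) (τ + N - δ i) := by
    refine ⟨∑ i, ((u i).natDegree + (δ i - τ).natAbs), fun i => ?_⟩
    refine (degreeAtMost_natCast.2 le_rfl).mono ?_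
    have := Finset.single_le_sum (f := fun i => (u i).natDegree + (δ i - τ).natAbs)
      (fun _ _ => Nat.zero_le _) (Finset.mem_univ i)
    omega
  exact descend N hN i

variable [Fintype κ]

theorem shiftedDegree_le_iff {s : κ → ℤ} {p : κ → 𝕜[X]} {t : ℤ} :
    shiftedDegree s p ≤ t ↔ ∀ j, DegreeAtMost (p j) (t - s j) := by
  simp only [shiftedDegree, Finset.sup_le_iff, Finset.mem_univ, true_implies]
  refine forall_congr' fun j => ?_
  by_cases h : p j = 0
  · simp [h, degreeAtMost_zero]
  · rw [Polynomial.degree_eq_natDegree h]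
    have : (s j : WithBot ℤ) + WithBot.map (fun d : ℕ => (d : ℤ)) ((p j).natDegree : WithBot ℕ)
        = ((s j + (p j).natDegree : ℤ) : WithBot ℤ) := rfl
    rw [this, WithBot.coe_le_coe]
    constructor
    · intro hle
      exact (degreeAtMost_natCast.2 le_rfl).mono (by omega)
    · intro hd
      by_contra hlt
      exact h (Polynomial.leadingCoeff_eq_zero.1 (hd _ (by omega)))

variable [Fintype ι]

theorem IsReduced.linearIndependent {s : κ → ℤ} {P : Matrix ι κ 𝕜[X]} (h : IsReduced s P) :
    LinearIndependent 𝕜 (leadingMatrix s P).row := by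
  rw [linearIndependent_iff_card_eq_finrank_span, Set.finrank, ← Matrix.rank_eq_finrank_span_row]
  exact h.symm

/-- A reduced matrix has finite row degrees `δ`, and its leading matrix is given by the
coefficients of degree `δ i - s j`. -/
theorem IsReduced.exists_rowDegree {s : κ → ℤ} {P : Matrix ι κ 𝕜[X]} (h : IsReduced s P) :
    ∃ δ : ι → ℤ, (∀ i, rowDegree s P i = δ i) ∧ (∀ i j, DegreeAtMost (P i j) (δ i - s j)) ∧
      LinearIndependent 𝕜 (Matrix.of fun i j => intCoeff (P i j) (δ i - s j)).row := by
  have hL := h.linearIndependent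
  have hex : ∀ i, ∃ d : ℤ, rowDegree s P i = d := fun i => by
    have hne := hL.ne_zero i
    rcases hd : rowDegree s P i with _ | d
    · refine absurd ?_ hne
      ext j
      simp [Matrix.row, leadingMatrix, hd]
    · exact ⟨d, rfl⟩
  choose δ hδ using hex
  refine ⟨δ, hδ, fun i => shiftedDegree_le_iff.1 (hδ i).le, ?_⟩
  convert hL using 2
  ext i j
  simp [leadingMatrix, hδ i]

end

/-! ### Dimension count and column reducedness -/

section

variable {𝕜 : Type*} [Field 𝕜] {ι κ ν : Type*} [Fintype ι] [Fintype κ]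

/-- Some `F.rank` columns of `F` have the same left kernel as `F`. -/
theorem exists_finset_vecMul_eq_zero (F : Matrix ι κ 𝕜[X]) :
    ∃ J : Finset κ, J.card ≤ F.rank ∧
      ∀ p : ι → 𝕜[X], (∀ j ∈ J, (p ᵥ* F) j = 0) → p ᵥ* F = 0 := by
  classical
  obtain ⟨t, ht, hmax⟩ := exists_maximal_linearIndepOn 𝕜[X] F.col
  refine ⟨t.toFinset, ?_, fun p hp => ?_⟩
  · rw [Matrix.rank_eq_finrank_span_cols]
    have hcard := finrank_span_eq_card ht
    rw [Set.toFinset_card, ← hcard]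
    exact Submodule.finrank_mono (Submodule.span_mono (Set.range_comp_subset_range _ _))
  · ext1 j
    by_cases hj : j ∈ t
    · exact hp j (by simpa using hj)
    -- Over a ring, maximality only puts a nonzero multiple of the column in the span; the factor a
    -- is cancelled at the end.
    obtain ⟨a, ha, hmem⟩ := hmax j hj
    have hle : Submodule.span 𝕜[X] (F.col '' t) ≤ LinearMap.ker (dotProductBilin 𝕜[X] 𝕜[X] p) := by
      rw [Submodule.span_le]
      rintro _ ⟨i, hi, rfl⟩
      exact hp i (by simpa using hi)
    have h0 : p ⬝ᵥ (a • F.col j) = 0 := hle hmem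
    rw [dotProduct_smul, smul_eq_mul] at h0
    exact (mul_eq_zero.1 h0).resolve_left ha

theorem finrank_degreeLT (d : ℕ) : Module.finrank 𝕜 (Polynomial.degreeLT 𝕜 d) = d := by
  rw [(Polynomial.degreeLTEquiv 𝕜 d).finrank_eq, Module.finrank_fin_fun]

instance finite_degreeLT (d : ℕ) : Module.Finite 𝕜 (Polynomial.degreeLT 𝕜 d) :=
  Module.Finite.equiv (Polynomial.degreeLTEquiv 𝕜 d).symm

/-- The inclusion of the vectors with entries of degrees less than `d` into all vectors. -/
noncomputable def inclDegreeLT (𝕜 : Type*) [Field 𝕜] {ι : Type*} (d : ι → ℕ) :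
    (∀ i, Polynomial.degreeLT 𝕜 (d i)) →ₗ[𝕜] (ι → 𝕜[X]) :=
  LinearMap.pi fun i => (Polynomial.degreeLT 𝕜 (d i)).subtype ∘ₗ LinearMap.proj i

theorem inclDegreeLT_injective {α : Type*} (d : α → ℕ) : Function.Injective (inclDegreeLT 𝕜 d) :=
  fun _ _ h => funext fun i => Subtype.ext (congrFun h i)

/-- Counting dimensions of the vectors of `s`-degree less than `T` in the left kernel of `F`. -/
theorem card_mul_le_of_leftKernel_le_span [Fintype ν] {F : Matrix ι κ 𝕜[X]} {s : ι → ℕ}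
    (hF : ∀ i j, DegreeAtMost (F i j) (s i)) {B : Matrix ν ι 𝕜[X]} {δ : ν → ℤ}
    (hδ : ∀ i, 0 ≤ δ i) (hB : ∀ i j, DegreeAtMost (B i j) (δ i - s j))
    (hL : LinearIndependent 𝕜 (Matrix.of fun i j => intCoeff (B i j) (δ i - s j)).row)
    (hspan : leftKernel F ≤ Submodule.span 𝕜[X] (Set.range fun i => B i)) (T : ℕ) :
    Fintype.card ι * T ≤ ∑ i, s i + F.rank * T + Fintype.card {i // δ i < T} * T := by
  classical
  obtain ⟨J, hJ, hJF⟩ := exists_finset_vecMul_eq_zero F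
  -- Truncated subtraction: entries with s i ≥ T are forced to be zero.
  let e := inclDegreeLT 𝕜 (fun i => T - s i)
  have he : ∀ p i, DegreeAtMost (e p i) ((T : ℤ) - 1 - s i) := fun p i => by
    have := mem_degreeLT_iff.1 (p i).2
    rcases le_or_gt (s i) T with h | h
    · exact this.mono (by omega)
    · rw [show e p i = 0 from this.eq_zero (by omega)]
      exact degreeAtMost_zero _
  let φ : (∀ i, Polynomial.degreeLT 𝕜 (T - s i)) →ₗ[𝕜] (J → Polynomial.degreeLT 𝕜 T) :=
    LinearMap.pi fun j => LinearMap.codRestrict _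
      (LinearMap.proj (j : κ) ∘ₗ F.vecMulLinear.restrictScalars 𝕜 ∘ₗ e) fun p =>
        mem_degreeLT_iff.2 <| DegreeAtMost.sum fun i _ =>
          ((he p i).mul (hF i j)).mono (by omega)
  let ψ : ({i // δ i < T} → Polynomial.degreeLT 𝕜 T) →ₗ[𝕜] (ι → 𝕜[X]) :=
    (B.submatrix Subtype.val id).vecMulLinear.restrictScalars 𝕜 ∘ₗ inclDegreeLT 𝕜 (fun _ => T)
  have hker : (LinearMap.ker φ).map e ≤ LinearMap.range ψ := by
    rintro _ ⟨p, hp, rfl⟩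
    have hpF : e p ∈ leftKernel F := hJF _ fun j hj =>
      congrArg Subtype.val (congrFun (LinearMap.mem_ker.1 hp) ⟨j, hj⟩)
    obtain ⟨c, hc⟩ := (Submodule.mem_span_range_iff_exists_fun _).1 (hspan hpF)
    rw [← Matrix.vecMul_eq_sum] at hc
    -- The bound T - 1 - δ i is negative when δ i ≥ T, so those rows drop out.
    have hcdeg := degreeAtMost_of_vecMul hB hL (u := c) (τ := T - 1) fun j => hc ▸ he p j
    refine ⟨fun i => ⟨c i, mem_degreeLT_iff.2 ((hcdeg i).mono (by have := hδ i; omega))⟩, ?_⟩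
    rw [← hc]
    ext1 j
    change ∑ i : {i // δ i < T}, c i * B i j = ∑ i, c i * B i j
    have hlarge : ∑ i : {i // ¬ δ i < T}, c i * B i j = 0 := Finset.sum_eq_zero fun i _ => by
      rw [(hcdeg i).eq_zero (by have := i.2; omega), zero_mul]
    have hsplit := Fintype.sum_subtype_add_sum_subtype (fun i => δ i < T) fun i => c i * B i j
    rwa [hlarge, add_zero] at hsplit
  have h1 := LinearMap.finrank_range_add_finrank_ker φ
  have h2 : Module.finrank 𝕜 (LinearMap.range φ) ≤ J.card * T := by
    refine (Submodule.finrank_le _).trans ?_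
    simp [Module.finrank_pi_fintype, finrank_degreeLT]
  have h3 : Module.finrank 𝕜 (LinearMap.ker φ) ≤ Fintype.card {i // δ i < T} * T := by
    rw [(Submodule.equivMapOfInjective e (inclDegreeLT_injective _) _).finrank_eq]
    refine (Submodule.finrank_mono hker).trans ((LinearMap.finrank_range_le ψ).trans ?_)
    simp [Module.finrank_pi_fintype, finrank_degreeLT]
  rw [Module.finrank_pi_fintype] at h1
  simp only [finrank_degreeLT] at h1
  have h4 : Fintype.card ι * T ≤ ∑ i, s i + ∑ i, (T - s i) := by
    rw [← Finset.sum_add_distrib, ← smul_eq_mul, ← Finset.card_univ, ← Finset.sum_const]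
    exact Finset.sum_le_sum fun i _ => by omega
  have h5 := Nat.mul_le_mul_right T hJ
  omega

/-- If `M` is column reduced with column degrees at least `τ`, then no nonzero vector of the row
space of `M` has degree less than `τ`. -/
theorem IsColReduced.vecMul_eq_zero {M : Matrix κ κ 𝕜[X]} (hM : IsColReduced M) {τ : ℤ}
    (hτ : ∀ j, (τ : WithBot ℤ) ≤ colDegree M j) {q : κ → 𝕜[X]}
    (hq : ∀ j, DegreeAtMost ((q ᵥ* M) j) (τ - 1)) : q ᵥ* M = 0 := by
  classical
  obtain ⟨δ, hδ, hdeg, hL⟩ := IsReduced.exists_rowDegree hM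
  have hL' := (Matrix.linearIndependent_row_iff.1 hL).transpose.linearIndependent_row
  -- Column degrees enter as the shift -δ with all row degrees 0. M is square, so its column leading
  -- matrix also has independent rows; the bound -1 forces q = 0.
  have key := degreeAtMost_of_vecMul (B := M) (δ := 0) (σ := fun j => -δ j) (u := q) (τ := -1)
    (fun i j => (hdeg j i).mono (by simp))
    (by simpa [Matrix.transpose] using hL')
    (fun j => (hq j).mono (by
      have : (τ : WithBot ℤ) ≤ δ j := (hτ j).trans (hδ j).le
      rw [WithBot.coe_le_coe] at this
      omega))
  rw [show q = 0 from funext fun i => (key i).eq_zero (by simp), Matrix.zero_vecMul]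

end

end PolyMat

open PolyMat in
theorem mainTheorem5 {𝕜 : Type*} [Field 𝕜] {m n r : ℕ}
    (F : Matrix (Fin m) (Fin n) 𝕜[X]) (hr : F.rank = r)
    (s : Fin m → ℕ) (hs : ∀ i, PolyMat.rowDegree 0 F i ≤ ((s i : ℤ) : WithBot ℤ))
    (hs0 : 0 < ∑ i, s i)
    (k : ℝ) (hk : 0 < k) (τ : ℤ) (hτ : τ = ⌈((∑ i, s i : ℕ) : ℝ) / k⌉) :
    (∀ K : Matrix (Fin (m - r)) (Fin m) 𝕜[X],
      PolyMat.IsRowBasis K (PolyMat.leftKernel F) →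
      PolyMat.IsReduced (fun i => (s i : ℤ)) K →
      {i | (τ : WithBot ℤ) ≤ PolyMat.rowDegree (fun i => (s i : ℤ)) K i}.ncard ≤ ⌊k⌋₊) ∧
    (∀ M : Matrix (Fin n) (Fin n) 𝕜[X],
      PolyMat.IsColReduced M →
      (∀ j, (τ : WithBot ℤ) ≤ PolyMat.colDegree M j) →
      ∀ A : Matrix (Fin m) (Fin m) 𝕜[X],
        PolyMat.IsRowBasis A (PolyMat.relationModule M F) →
        PolyMat.IsReduced (fun i => (s i : ℤ)) A →
        {i | A i ∉ PolyMat.leftKernel F}.ncard ≤ r + ⌊k⌋₊) := by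
  have hF : ∀ i j, DegreeAtMost (F i j) (s i) := fun i j => by
    simpa using shiftedDegree_le_iff.1 (hs i) j
  have hτ0 : 0 < τ := by
    rw [hτ, Int.ceil_pos]
    exact div_pos (by exact_mod_cast hs0) hk
  lift τ to ℕ using hτ0.le with T
  have hT0 : (0 : ℝ) < T := by exact_mod_cast hτ0
  have hTk : ((∑ i, s i : ℕ) : ℝ) ≤ k * T := by
    have h := Int.le_ceil (((∑ i, s i : ℕ) : ℝ) / k)
    rw [← hτ, div_le_iff₀ hk] at h
    simpa [mul_comm] using h
  -- Used with N = m - r for (1) and N = m for (2).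
  have count : ∀ {N : ℕ} {B : Matrix (Fin N) (Fin m) 𝕜[X]} {δ : Fin N → ℤ},
      (∀ i, rowDegree (fun i => (s i : ℤ)) B i = δ i) →
      (∀ i j, DegreeAtMost (B i j) (δ i - s j)) →
      LinearIndependent 𝕜 (Matrix.of fun i j => intCoeff (B i j) (δ i - s j)).row →
      leftKernel F ≤ Submodule.span 𝕜[X] (Set.range fun i => B i) →
      {i | ((T : ℤ) : WithBot ℤ) ≤ rowDegree (fun i => (s i : ℤ)) B i}.ncard + m ≤
        N + r + ⌊k⌋₊ := by
    intro N B δ hδ hB hL hspan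
    -- As s ≥ 0, a negative δ i would give a zero row in the leading matrix.
    have hδ0 : ∀ i, 0 ≤ δ i := fun i => by
      by_contra hneg
      refine hL.ne_zero i (funext fun j => ?_)
      simp [Matrix.row, intCoeff, show ¬ ((s j : ℤ) ≤ δ i) by omega]
    have h := card_mul_le_of_leftKernel_le_span hF hδ0 hB hL hspan T
    rw [Fintype.card_fin, hr] at h
    have hcompl := Fintype.card_subtype_compl (fun i => δ i < (T : ℤ))
    have hle := Fintype.card_subtype_le (fun i => δ i < (T : ℤ))
    rw [Fintype.card_fin] at hcompl hle
    have hset : {i | ((T : ℤ) : WithBot ℤ) ≤ rowDegree (fun i => (s i : ℤ)) B i}.ncard =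
        Fintype.card {i // ¬ δ i < (T : ℤ)} := by
      rw [← Nat.card_eq_fintype_card, ← Nat.card_coe_set_eq]
      refine Nat.card_congr (Equiv.subtypeEquivRight fun i => ?_)
      rw [Set.mem_ofPred_eq, hδ, WithBot.coe_le_coe, not_lt]
    have hreal : (m : ℝ) * T ≤ (k + r + Fintype.card {i // δ i < (T : ℤ)}) * T := by
      have h' : (m : ℝ) * T ≤ ((∑ i, s i : ℕ) : ℝ) + r * T
          + Fintype.card {i // δ i < (T : ℤ)} * T := by exact_mod_cast h
      linarith
    have hfloor : m - r - Fintype.card {i // δ i < (T : ℤ)} ≤ ⌊k⌋₊ := by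
      rcases le_or_gt m (r + Fintype.card {i // δ i < (T : ℤ)}) with hm | hm
      · omega
      · refine Nat.le_floor ?_
        rw [Nat.sub_sub, Nat.cast_sub hm.le]
        push_cast
        linarith [le_of_mul_le_mul_right hreal hT0]
    omega
  refine ⟨fun K hK hred => ?_, fun M hM hMτ A hA hred => ?_⟩
  · obtain ⟨δ, hδ, hdeg, hL⟩ := hred.exists_rowDegree
    have hrm : r ≤ m := hr ▸ F.rank_le_height
    have := count hδ hdeg hL hK.2.ge
    omega
  · obtain ⟨δ, hδ, hdeg, hL⟩ := hred.exists_rowDegree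
    have hker : leftKernel F ≤ Submodule.span 𝕜[X] (Set.range fun i => A i) := by
      rw [hA.2]
      intro p hp
      exact ⟨0, by rw [map_zero]; exact hp.symm⟩
    have hcount := count hδ hdeg hL hker
    have hsub : {i | A i ∉ leftKernel F} ⊆
        {i | ((T : ℤ) : WithBot ℤ) ≤ rowDegree (fun i => (s i : ℤ)) A i} := by
      intro i hi
      by_contra hlt
      rw [Set.mem_ofPred_eq, hδ, WithBot.coe_le_coe, not_le] at hlt
      have hmem : A i ∈ relationModule M F := hA.2 ▸ Submodule.subset_span ⟨i, rfl⟩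
      obtain ⟨q, hq⟩ := hmem
      rw [Matrix.vecMulLinear_apply, Matrix.vecMulLinear_apply] at hq
      refine hi (hq.symm.trans (hM.vecMul_eq_zero hMτ fun j => ?_))
      rw [hq]
      change DegreeAtMost (∑ l, A i l * F l j) _
      refine DegreeAtMost.sum fun l _ => ?_
      exact ((hdeg i l).mul (hF l j)).mono (by omega)
    have := Set.ncard_le_ncard hsub
    omega
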